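/- Let $G$ be a (discrete) group. A \emph{family of subgroups} of $G$ is a non-empty set of subgroups of $G$ closed under conjugation and under taking subgroups. For a family $\mathcal F$ and a subgroup $H\le G$ write $\mathcal F|_H=\{L\cap H : L\in\mathcal F\}$, a family of subgroups of $H$, and let $G/\mathcal F=\coprod_{H\in\mathcal F}G/H$. We say that $G$ is \emph{finite relative to} $\mathcal F$ if $\mathcal F$ contains a finite-index subgroup of $G$. A \emph{normed $\mathbb RG$-module} is a real normed vector space $V$ with a linear isometric action of $G$. For such $V$ let $C^n_{\mathcal F,b}(G;V)$ be the space of $\mathbb R$-linear maps $\mathbb R[(G/\mathcal F)^{n+1}]\to V$ with finite operator norm, where $\mathbb R[(G/\mathcal F)^{n+1}]$ carries the $\ell^1$-norm with respect to its basis; let $G$ act by $(g\cdot f)(c)=g\cdot f(g^{-1}c)$, and let $$\delta^n(f)(x_0,\dots,x_{n+1})=\sum_{i=0}^{n+1}(-1)^i f(x_0,\dots,\widehat{x_i},\dots,x_{n+1}).$$ The bounded Bredon cohomology is $H^n_{\mathcal F,b}(G;V)=H^n\big(C^*_{\mathcal F,b}(G;V)^G\big)$, $n\ge 0$. For families $\mathcal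 F\subset\mathcal G$ the inclusion $G/\mathcal F\subset G/\mathcal G$ induces the canonical map $\mathrm{can}^n\colon H^n_{\mathcal G,b}(G;V)\to H^n_{\mathcal F,b}(G;V)$. Let $\ell^1(G/\mathcal F)$ be the normed $\mathbb RG$-module of summable functions $f\colon G/\mathcal F\to\mathbb R$ with norm $\|f\|_1=\sum_{x\in G/\mathcal F}|f(x)|$ and the translation action $(g\cdot f)(x)=f(g^{-1}x)$, and let $\ell^1_0(G/\mathcal F)$ be the kernel of the summation map $f\mapsto\sum_{x\in G/\mathcal F} f(x)$. Let $[K_{\mathcal F}]\in H^1_{\mathcal F,b}(G;\ell^1_0(G/\mathcal F))$ be the class of the $1$-cocycle $K_{\mathcal F}(x_0,x_1)=\chi_{x_1}-\chi_{x_0}$, where $\chi_x$ is the characteristic function of $\{x\}$. \textbf{Theorem.} Let $G$ be a group and let $\mathcal F\subset\mathcal G$ be two families of subgroups of $G$. The following are equivalent: (i) every subgroup $H\in\mathcal G$ is finite relative to $\mathcal F|_H$; (ii) the canonical map $H^n_{\mathcal G,b}(G;V)\to H^n_{\mathcal F,b}(G;V)$ is an isomorphism of real vector spaces for every normed $\mathbb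 RG$-module $V$ and all $n\ge 0$; (iii) the canonical map $H^1_{\mathcal G,b}(G;V)\to H^1_{\mathcal F,b}(G;V)$ is an isomorphism of real vector spaces for every normed $\mathbb RG$-module $V$; (iv) the class $[K_{\mathcal F}]\in H^1_{\mathcal F,b}(G;\ell^1_0(G/\mathcal F))$ lies in the image of the canonical map $\mathrm{can}^1\colon H^1_{\mathcal G,b}(G;\ell^1_0(G/\mathcal F))\to H^1_{\mathcal F,b}(G;\ell^1_0(G/\mathcal F))$. -/

import Mathlib

noncomputable section

namespace BoundedBredon

/-! ### Families of subgroups -/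

/-- A family of subgroups of `G`: a non-empty set of subgroups that is closed under conjugation
and under passing to subgroups. -/
structure SubgroupFamily (G : Type*) [Group G] where
  carrier : Set (Subgroup G)
  nonempty : carrier.Nonempty
  conj_mem : ∀ H ∈ carrier, ∀ g : G, H.map (MulAut.conj g).toMonoidHom ∈ carrier
  of_le : ∀ H ∈ carrier, ∀ K : Subgroup G, K ≤ H → K ∈ carrier

/-- The restricted family `F|_H = {L ∩ H | L ∈ F}`, as a family of subgroups of `H`. -/
def SubgroupFamily.restrict {G : Type*} [Group G] (F : SubgroupFamily G) (H : Subgroup G) :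
    SubgroupFamily H where
  carrier := {K | ∃ L ∈ F.carrier, K = L.subgroupOf H}
  nonempty := by
    obtain ⟨L, hL⟩ := F.nonempty
    exact ⟨_, L, hL, rfl⟩
  conj_mem := by
    rintro _ ⟨L, hL, rfl⟩ h
    refine ⟨L.map (MulAut.conj (h : G)).toMonoidHom, F.conj_mem L hL h, ?_⟩
    ext x
    simp only [Subgroup.mem_map, Subgroup.mem_subgroupOf]
    constructor
    · rintro ⟨y, hy, rfl⟩
      exact ⟨(y : G), hy, by simp⟩
    · rintro ⟨y, hy, hyx⟩
      have hyx' : (h : G) * y * (h : G)⁻¹ = (x : G) := by simpa using hyx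
      have hy' : ((h⁻¹ * x * h : H) : G) = y := by
        rw [Subgroup.coe_mul, Subgroup.coe_mul, Subgroup.coe_inv, ← hyx']
        group
      refine ⟨h⁻¹ * x * h, by rw [hy']; exact hy, ?_⟩
      simp [mul_assoc]
  of_le := by
    rintro _ ⟨L, hL, rfl⟩ K hK
    refine ⟨K.map H.subtype, F.of_le L hL _ ?_, ?_⟩
    · rintro _ ⟨k, hk, rfl⟩
      exact hK hk
    · exact (Subgroup.comap_map_eq_self_of_injective H.subtype_injective K).symm

/-- `G` is finite relative to `F` if `F` contains a finite-index subgroup of `G`. -/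
def FiniteRelative {G : Type*} [Group G] (F : SubgroupFamily G) : Prop :=
  ∃ K ∈ F.carrier, K.FiniteIndex

/-- The `G`-set `G/F`, the disjoint union of the coset spaces `G/H` over all `H ∈ F`. -/
abbrev Cosets {G : Type*} [Group G] (F : SubgroupFamily G) : Type _ :=
  Σ H : {H : Subgroup G // H ∈ F.carrier}, G ⧸ H.1

/-- For `F ⊆ F'`, the inclusion `G/F → G/F'` of `G`-sets. -/
def cosetsIncl {G : Type*} [Group G] {F F' : SubgroupFamily G} (h : F.carrier ⊆ F'.carrier) :
    Cosets F →[G] Cosets F' where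
  toFun x := ⟨⟨x.1.1, h x.1.2⟩, x.2⟩
  map_smul' _ _ := rfl

/-! ### Chains and bounded linear maps -/

/-- The `ℓ¹`-norm on the free real vector space `ℝ[X]` with respect to its basis `X`. -/
def l1Norm {X : Type*} (c : X →₀ ℝ) : ℝ := c.sum fun _ r => |r|

/-- The real vector space `bHom(ℝ[X], V)` of linear maps of finite operator norm, where `ℝ[X]`
carries the `ℓ¹`-norm. -/
def bHom (X : Type*) (V : Type*) [NormedAddCommGroup V] [NormedSpace ℝ V] :
    Submodule ℝ ((X →₀ ℝ) →ₗ[ℝ] V) where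
  carrier := {f | ∃ C : ℝ, ∀ c, ‖f c‖ ≤ C * l1Norm c}
  zero_mem' := ⟨0, fun c => by simp⟩
  add_mem' := by
    rintro f f' ⟨C, hC⟩ ⟨C', hC'⟩
    refine ⟨C + C', fun c => ?_⟩
    rw [add_mul]
    exact (norm_add_le _ _).trans (add_le_add (hC c) (hC' c))
  smul_mem' := by
    rintro r f ⟨C, hC⟩
    refine ⟨|r| * C, fun c => ?_⟩
    rw [LinearMap.smul_apply, norm_smul, Real.norm_eq_abs, mul_assoc]
    exact mul_le_mul_of_nonneg_left (hC c) (abs_nonneg r)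

/-- A linear map on `ℝ[X]` has finite operator norm if and only if it is bounded on `X`. -/
theorem mem_bHom_iff {X : Type*} {V : Type*} [NormedAddCommGroup V] [NormedSpace ℝ V]
    (f : (X →₀ ℝ) →ₗ[ℝ] V) :
    f ∈ bHom X V ↔ ∃ C : ℝ, ∀ x, ‖f (Finsupp.single x 1)‖ ≤ C := by
  constructor
  · rintro ⟨C, hC⟩
    exact ⟨C, fun x => by simpa [l1Norm] using hC (Finsupp.single x 1)⟩
  · rintro ⟨C, hC⟩
    refine ⟨C, fun c => ?_⟩
    have hc : f c = c.sum fun x r => r • f (Finsupp.single x 1) := by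
      conv_lhs => rw [← Finsupp.sum_single c]
      rw [map_finsuppSum]
      refine Finsupp.sum_congr fun x _ => ?_
      rw [← map_smul, Finsupp.smul_single, smul_eq_mul, mul_one]
    rw [hc, l1Norm, Finsupp.sum, Finsupp.sum, Finset.mul_sum]
    refine norm_sum_le_of_le _ fun x _ => ?_
    rw [norm_smul, Real.norm_eq_abs, mul_comm]
    exact mul_le_mul_of_nonneg_right (hC x) (abs_nonneg _)

/-- The chain module `C_n = ℝ[S^(n+1)]`. -/
abbrev Chains (S : Type*) (n : ℕ) : Type _ := (Fin (n + 1) → S) →₀ ℝ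

/-- The boundary map `∂(s₀, …, sₙ₊₁) = ∑ᵢ (-1)ⁱ (s₀, …, ŝᵢ, …, sₙ₊₁)`. -/
def boundary (S : Type*) (n : ℕ) : Chains S (n + 1) →ₗ[ℝ] Chains S n :=
  ∑ i : Fin (n + 2), (-1 : ℝ) ^ (i : ℕ) • Finsupp.lmapDomain ℝ ℝ (fun s => s ∘ i.succAbove)

/-- The map `C_n(S) → C_n(T)` induced by a map `S → T`. -/
def chainsMap {S T : Type*} (φ : S → T) (n : ℕ) : Chains S n →ₗ[ℝ] Chains T n :=
  Finsupp.lmapDomain ℝ ℝ (fun s => φ ∘ s)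

theorem boundary_single {S : Type*} (n : ℕ) (s : Fin (n + 2) → S) :
    boundary S n (Finsupp.single s 1) =
      ∑ i : Fin (n + 2), (-1 : ℝ) ^ (i : ℕ) • Finsupp.single (s ∘ i.succAbove) 1 := by
  simp [boundary, LinearMap.sum_apply, Finsupp.mapDomain_single]

theorem chainsMap_single {S T : Type*} (φ : S → T) (n : ℕ) (s : Fin (n + 1) → S) :
    chainsMap φ n (Finsupp.single s 1) = Finsupp.single (φ ∘ s) 1 := by
  simp [chainsMap, Finsupp.mapDomain_single]

theorem boundary_chainsMap {S T : Type*} (φ : S → T) (n : ℕ) (c : Chains S (n + 1)) :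
    boundary T n (chainsMap φ (n + 1) c) = chainsMap φ n (boundary S n c) := by
  suffices h : (boundary T n).comp (chainsMap φ (n + 1)) = (chainsMap φ n).comp (boundary S n) from
    LinearMap.congr_fun h c
  refine Finsupp.lhom_ext' fun s => LinearMap.ext_ring ?_
  simp only [LinearMap.comp_apply, Finsupp.lsingle_apply, chainsMap_single, boundary_single,
    map_sum, map_smul, Function.comp_assoc]

theorem boundary_boundary {S : Type*} (n : ℕ) (c : Chains S (n + 2)) :
    boundary S n (boundary S (n + 1) c) = 0 := by
  suffices h : (boundary S n).comp (boundary S (n + 1)) = 0 from LinearMap.congr_fun h c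
  refine Finsupp.lhom_ext' fun s => LinearMap.ext_ring ?_
  simp only [LinearMap.comp_apply, Finsupp.lsingle_apply, boundary_single, map_sum, map_smul,
    LinearMap.zero_apply, Finset.smul_sum, smul_smul, ← pow_add]
  rw [← Finset.sum_product']
  refine Finset.sum_involution
    (fun p _ => (p.1.succAbove p.2, p.2.predAbove p.1)) ?_ ?_ ?_ ?_
  · rintro ⟨i, j⟩ -
    have hs : (s ∘ (i.succAbove j).succAbove) ∘ (j.predAbove i).succAbove
        = (s ∘ i.succAbove) ∘ j.succAbove := by
      funext k
      simp [Fin.succAbove_succAbove_succAbove_predAbove]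
    have hp : (-1 : ℝ) ^ ((i.succAbove j : ℕ) + (j.predAbove i : ℕ))
        = -(-1 : ℝ) ^ ((i : ℕ) + (j : ℕ)) := by
      rw [Fin.neg_one_pow_succAbove_add_predAbove, pow_add]
    simp only [hs, hp]
    simp
  · rintro ⟨i, j⟩ - - h
    exact Fin.succAbove_ne i j (congrArg Prod.fst h)
  · intro p _
    exact Finset.mem_univ _
  · rintro ⟨i, j⟩ -
    simp [Fin.succAbove_succAbove_predAbove, Fin.predAbove_predAbove_succAbove]

theorem comp_boundary_mem {S : Type*} {V : Type*} [NormedAddCommGroup V] [NormedSpace ℝ V] {n : ℕ}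
    {f : Chains S n →ₗ[ℝ] V} (hf : f ∈ bHom _ V) : f.comp (boundary S n) ∈ bHom _ V := by
  obtain ⟨C, hC⟩ := (mem_bHom_iff f).1 hf
  refine (mem_bHom_iff _).2 ⟨∑ _i : Fin (n + 2), C, fun s => ?_⟩
  rw [LinearMap.comp_apply, boundary_single, map_sum]
  refine norm_sum_le_of_le _ fun i _ => ?_
  rw [map_smul, norm_smul, norm_pow, norm_neg, norm_one, one_pow, one_mul]
  exact hC _

theorem comp_chainsMap_mem {S T : Type*} {V : Type*} [NormedAddCommGroup V] [NormedSpace ℝ V]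
    (φ : S → T) {n : ℕ} {f : Chains T n →ₗ[ℝ] V} (hf : f ∈ bHom _ V) :
    f.comp (chainsMap φ n) ∈ bHom _ V := by
  obtain ⟨C, hC⟩ := (mem_bHom_iff f).1 hf
  refine (mem_bHom_iff _).2 ⟨C, fun s => ?_⟩
  rw [LinearMap.comp_apply, chainsMap_single]
  exact hC _

/-! ### Bounded cohomology of a `G`-set

A normed `ℝG`-module is a real normed space `V` with a homomorphism `ρ` from `G` to the group of
linear isometries of `V`. -/

/-- The `G`-invariants `bHom(ℝ[S^(n+1)], V)^G`, where `G` acts on linear maps by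
`(g • f)(c) = g • f(g⁻¹ • c)`. -/
def invariantHoms {G : Type*} [Group G] (S : Type*) [MulAction G S]
    {V : Type*} [NormedAddCommGroup V] [NormedSpace ℝ V] (ρ : G →* (V ≃ₗᵢ[ℝ] V)) (n : ℕ) :
    Submodule ℝ (Chains S n →ₗ[ℝ] V) where
  carrier := {f | f ∈ bHom _ V ∧
    ∀ (g : G) (c : Chains S n), ρ g (f (chainsMap (fun x : S => g⁻¹ • x) n c)) = f c}
  zero_mem' := ⟨Submodule.zero_mem _, fun g c => by simp⟩
  add_mem' := by
    rintro f f' ⟨hf, hfi⟩ ⟨hf', hfi'⟩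
    exact ⟨Submodule.add_mem _ hf hf', fun g c => by
      rw [LinearMap.add_apply, map_add, hfi, hfi', LinearMap.add_apply]⟩
  smul_mem' := by
    rintro r f ⟨hf, hfi⟩
    exact ⟨Submodule.smul_mem _ r hf, fun g c => by
      rw [LinearMap.smul_apply, map_smul, hfi, LinearMap.smul_apply]⟩

/-- The `n`-cochains `bHom(ℝ[S^(n+1)], V)^G`, as a real vector space. -/
def Cochains {G : Type*} [Group G] (S : Type*) [MulAction G S]
    {V : Type*} [NormedAddCommGroup V] [NormedSpace ℝ V] (ρ : G →* (V ≃ₗᵢ[ℝ] V)) (n : ℕ) :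
    Type _ :=
  ↥(invariantHoms S ρ n)

section

variable {G : Type*} [Group G] (S : Type*) [MulAction G S]
  {V : Type*} [NormedAddCommGroup V] [NormedSpace ℝ V] (ρ : G →* (V ≃ₗᵢ[ℝ] V))

instance Cochains.addCommGroup (n : ℕ) : AddCommGroup (Cochains S ρ n) :=
  inferInstanceAs (AddCommGroup ↥(invariantHoms S ρ n))

instance Cochains.module (n : ℕ) : Module ℝ (Cochains S ρ n) :=
  inferInstanceAs (Module ℝ ↥(invariantHoms S ρ n))

/-- The differential `δⁿ(f) = f ∘ ∂`. -/
def coboundary (n : ℕ) : Cochains S ρ n →ₗ[ℝ] Cochains S ρ (n + 1) where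
  toFun f := Subtype.mk (f.1.comp (boundary S n)) ⟨comp_boundary_mem f.2.1, fun g c => by
    rw [LinearMap.comp_apply, LinearMap.comp_apply, boundary_chainsMap, f.2.2]⟩
  map_add' _ _ := rfl
  map_smul' _ _ := rfl

/-- The composite of two consecutive differentials vanishes. -/
theorem coboundary_coboundary (n : ℕ) (f : Cochains S ρ n) :
    coboundary S ρ (n + 1) (coboundary S ρ n f) = 0 := by
  refine Subtype.ext (LinearMap.ext fun c => ?_)
  change f.1 (boundary S n (boundary S (n + 1) c)) = 0
  rw [boundary_boundary, map_zero]

/-- The `n`-cocycles. -/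
def cocycles (n : ℕ) : Submodule ℝ (Cochains S ρ n) := LinearMap.ker (coboundary S ρ n)

/-- The `n`-coboundaries. -/
def coboundaries : (n : ℕ) → Submodule ℝ (Cochains S ρ n)
  | 0 => ⊥
  | n + 1 => LinearMap.range (coboundary S ρ n)

/-- The `n`-th cohomology of the complex `bHom(ℝ[S^(*+1)], V)^G`. -/
abbrev Cohomology (n : ℕ) : Type _ :=
  ↥(cocycles S ρ n) ⧸ (coboundaries S ρ n).submoduleOf (cocycles S ρ n)

end

section

variable {G : Type*} [Group G] {S T : Type*} [MulAction G S] [MulAction G T] (φ : S →[G] T)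
  {V : Type*} [NormedAddCommGroup V] [NormedSpace ℝ V] (ρ : G →* (V ≃ₗᵢ[ℝ] V))

/-- The cochain map induced by a `G`-map `S → T`. -/
def cochainsMap (n : ℕ) : Cochains T ρ n →ₗ[ℝ] Cochains S ρ n where
  toFun f := Subtype.mk (f.1.comp (chainsMap φ n)) ⟨comp_chainsMap_mem φ f.2.1, fun g c => by
    have h : chainsMap φ n (chainsMap (fun x : S => g⁻¹ • x) n c)
        = chainsMap (fun x : T => g⁻¹ • x) n (chainsMap φ n c) := by
      suffices h' : (chainsMap φ n).comp (chainsMap (fun x : S => g⁻¹ • x) n)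
          = (chainsMap (fun x : T => g⁻¹ • x) n).comp (chainsMap φ n) from
        LinearMap.congr_fun h' c
      refine Finsupp.lhom_ext' fun s => LinearMap.ext_ring ?_
      simp only [LinearMap.comp_apply, Finsupp.lsingle_apply, chainsMap_single]
      congr 1
      funext k
      simp
    rw [LinearMap.comp_apply, LinearMap.comp_apply, h, f.2.2]⟩
  map_add' _ _ := rfl
  map_smul' _ _ := rfl

theorem cochainsMap_coboundary (n : ℕ) (f : Cochains T ρ n) :
    coboundary S ρ n (cochainsMap φ ρ n f) = cochainsMap φ ρ (n + 1) (coboundary T ρ n f) := by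
  refine Subtype.ext (LinearMap.ext fun c => ?_)
  change f.1 (chainsMap φ n (boundary S n c)) = f.1 (boundary T n (chainsMap φ (n + 1) c))
  rw [boundary_chainsMap]

/-- The map on cocycles induced by a `G`-map `S → T`. -/
def cocyclesMap (n : ℕ) : cocycles T ρ n →ₗ[ℝ] cocycles S ρ n :=
  (cochainsMap φ ρ n).restrict fun f hf => by
    have hf' : coboundary T ρ n f = 0 := hf
    change coboundary S ρ n (cochainsMap φ ρ n f) = 0
    rw [cochainsMap_coboundary, hf', map_zero]

/-- The map on cohomology induced by a `G`-map `S → T`. -/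
def cohomologyMap (n : ℕ) : Cohomology T ρ n →ₗ[ℝ] Cohomology S ρ n :=
  Submodule.mapQ _ _ (cocyclesMap φ ρ n) (by
    intro f hf
    replace hf : f.1 ∈ coboundaries T ρ n := hf
    change cochainsMap φ ρ n f.1 ∈ coboundaries S ρ n
    cases n with
    | zero =>
      have hf' : f.1 = 0 := hf
      rw [hf', map_zero]
      exact Submodule.zero_mem _
    | succ n =>
      obtain ⟨b, hb⟩ := hf
      exact ⟨cochainsMap φ ρ n b, by rw [cochainsMap_coboundary, hb]⟩)

end

/-! ### Bounded Bredon cohomology -/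

/-- The bounded Bredon cohomology `Hⁿ_{F,b}(G; V)`. -/
abbrev BredonCohomology {G : Type*} [Group G] (F : SubgroupFamily G)
    {V : Type*} [NormedAddCommGroup V] [NormedSpace ℝ V] (ρ : G →* (V ≃ₗᵢ[ℝ] V)) (n : ℕ) :
    Type _ :=
  Cohomology (Cosets F) ρ n

/-- The canonical map `Hⁿ_{F',b}(G; V) → Hⁿ_{F,b}(G; V)` for families `F ⊆ F'`, induced by the
inclusion `G/F → G/F'`. -/
def can {G : Type*} [Group G] {F F' : SubgroupFamily G} (h : F.carrier ⊆ F'.carrier)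
    {V : Type*} [NormedAddCommGroup V] [NormedSpace ℝ V] (ρ : G →* (V ≃ₗᵢ[ℝ] V)) (n : ℕ) :
    BredonCohomology F' ρ n →ₗ[ℝ] BredonCohomology F ρ n :=
  cohomologyMap (cosetsIncl h) ρ n

/-! ### The module `ℓ¹₀(S)` and the class `[K_F]` -/

theorem summable_ell1 {S : Type*} (f : lp (fun _ : S => ℝ) 1) : Summable fun x => f x :=
  (lp.memℓp f).summable_of_one

/-- The space `ℓ¹₀(S)` of summable functions on `S` with sum zero, with the `ℓ¹`-norm. -/
def ell1Zero (S : Type*) : Submodule ℝ (lp (fun _ : S => ℝ) 1) where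
  carrier := {f | ∑' x, f x = 0}
  zero_mem' := by simp
  add_mem' := by
    intro f f' hf hf'
    rw [Set.mem_ofPred_eq] at *
    simp only [lp.coeFn_add, Pi.add_apply]
    rw [(summable_ell1 f).tsum_add (summable_ell1 f'), hf, hf', add_zero]
  smul_mem' := by
    intro r f hf
    rw [Set.mem_ofPred_eq] at *
    simp only [lp.coeFn_smul, Pi.smul_apply, smul_eq_mul]
    rw [tsum_mul_left, hf, mul_zero]

section

variable {G : Type*} [Group G] (S : Type*) [MulAction G S]

/-- The translate `x ↦ f (g⁻¹ • x)` of `f ∈ ℓ¹₀(S)`. -/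
def ell1ZeroTranslate (g : G) (f : ell1Zero S) : ell1Zero S :=
  ⟨⟨fun x => f.1 (g⁻¹ • x), by
    have h := (memℓp_gen_iff (p := 1) (by simp)).1 (lp.memℓp f.1)
    exact (memℓp_gen_iff (p := 1) (by simp)).2 ((MulAction.toPerm g⁻¹).summable_iff.2 h)⟩,
    ((MulAction.toPerm g⁻¹).tsum_eq (fun x : S => f.1 x)).trans f.2⟩

/-- The action of `G` on `ℓ¹₀(S)` by translation, `(g • f)(x) = f (g⁻¹ • x)`. -/
def ell1ZeroRep : G →* (ell1Zero S ≃ₗᵢ[ℝ] ell1Zero S) where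
  toFun g :=
    { toFun := ell1ZeroTranslate S g
      invFun := ell1ZeroTranslate S g⁻¹
      map_add' := fun _ _ => rfl
      map_smul' := fun _ _ => rfl
      left_inv := fun f => by
        refine Subtype.ext (lp.ext (funext fun x => ?_))
        change f.1 (g⁻¹ • g⁻¹⁻¹ • x) = f.1 x
        rw [inv_inv, inv_smul_smul]
      right_inv := fun f => by
        refine Subtype.ext (lp.ext (funext fun x => ?_))
        change f.1 (g⁻¹⁻¹ • g⁻¹ • x) = f.1 x
        rw [inv_inv, smul_inv_smul]
      norm_map' := fun f => by
        change ‖(ell1ZeroTranslate S g f).1‖ = ‖f.1‖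
        rw [lp.norm_eq_tsum_rpow (by simp), lp.norm_eq_tsum_rpow (by simp)]
        congr 1
        exact (MulAction.toPerm g⁻¹).tsum_eq (fun x : S => ‖f.1 x‖ ^ (1 : ENNReal).toReal) }
  map_one' := by
    refine LinearIsometryEquiv.ext fun f => Subtype.ext (lp.ext (funext fun x => ?_))
    change f.1 ((1 : G)⁻¹ • x) = f.1 x
    rw [inv_one, one_smul]
  map_mul' g g' := by
    refine LinearIsometryEquiv.ext fun f => Subtype.ext (lp.ext (funext fun x => ?_))
    change f.1 ((g * g')⁻¹ • x) = f.1 (g'⁻¹ • g⁻¹ • x)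
    rw [mul_inv_rev, mul_smul]

variable {S}

open Classical in
/-- The characteristic function of the point `x`, as an element of `ℓ¹(S)`. -/
def chi (x : S) : lp (fun _ : S => ℝ) 1 := lp.single 1 x (1 : ℝ)

open Classical in
theorem chi_apply (x y : S) : chi x y = if y = x then 1 else 0 := by
  rw [chi, lp.single_apply, Pi.single_apply]

open Classical in
theorem chi_smul (g : G) (x y : S) : chi (g • x) (g • y) = chi x y := by
  rw [chi_apply, chi_apply]
  exact if_congr (MulAction.injective g).eq_iff rfl rfl

theorem norm_chi (x : S) : ‖chi x‖ = 1 := by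
  classical
  rw [chi, lp.norm_single (by simp), norm_one]

/-- The difference `χ_y - χ_x`, as an element of `ℓ¹₀(S)`. -/
def chiDiff (x y : S) : ell1Zero S :=
  ⟨chi y - chi x, by
    change ∑' z, (chi y - chi x) z = 0
    simp only [lp.coeFn_sub, Pi.sub_apply]
    rw [(summable_ell1 _).tsum_sub (summable_ell1 _)]
    simp only [chi_apply, tsum_ite_eq, sub_self]⟩

variable (S)

/-- The linear map `ℝ[S²] → ℓ¹₀(S)` with `(s₀, s₁) ↦ χ_{s₁} - χ_{s₀}`. -/
def kMap : Chains S 1 →ₗ[ℝ] ell1Zero S :=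
  Finsupp.linearCombination ℝ fun s : Fin 2 → S => chiDiff (s 0) (s 1)

theorem kMap_single (s : Fin 2 → S) : kMap S (Finsupp.single s 1) = chiDiff (s 0) (s 1) := by
  rw [kMap, Finsupp.linearCombination_single, one_smul]

variable (G)

/-- `kMap` as an invariant bounded `1`-cochain. -/
def kCochain : Cochains S (ell1ZeroRep (G := G) S) 1 :=
  Subtype.mk (kMap S) ⟨(mem_bHom_iff _).2 ⟨1 + 1, fun s => by
      rw [kMap_single]
      change ‖chi (s 1) - chi (s 0)‖ ≤ 1 + 1
      refine (norm_sub_le _ _).trans ?_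
      rw [norm_chi, norm_chi]⟩, fun g c => by
    suffices h : ((ell1ZeroRep S g).toLinearEquiv.toLinearMap.comp (kMap S)).comp
        (chainsMap (fun x : S => g⁻¹ • x) 1) = kMap S from LinearMap.congr_fun h c
    refine Finsupp.lhom_ext' fun s => LinearMap.ext_ring ?_
    simp only [LinearMap.comp_apply, Finsupp.lsingle_apply, chainsMap_single, kMap_single]
    refine Subtype.ext (lp.ext (funext fun x => ?_))
    change chi (g⁻¹ • s 1) (g⁻¹ • x) - chi (g⁻¹ • s 0) (g⁻¹ • x) = chi (s 1) x - chi (s 0) x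
    rw [chi_smul, chi_smul]⟩

/-- `kMap` as a `1`-cocycle. -/
def kCocycle : cocycles S (ell1ZeroRep (G := G) S) 1 :=
  ⟨kCochain G S, by
    change coboundary S (ell1ZeroRep (G := G) S) 1 (kCochain G S) = 0
    refine Subtype.ext ?_
    change (kMap S).comp (boundary S 1) = 0
    refine Finsupp.lhom_ext' fun s => LinearMap.ext_ring ?_
    simp only [LinearMap.comp_apply, Finsupp.lsingle_apply, boundary_single, map_sum, map_smul,
      kMap_single, LinearMap.zero_apply]
    refine (Fin.sum_univ_three _).trans (Subtype.ext ?_)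
    change (-1 : ℝ) ^ 0 • (chi (s 2) - chi (s 1)) + (-1 : ℝ) ^ 1 • (chi (s 2) - chi (s 0))
      + (-1 : ℝ) ^ 2 • (chi (s 1) - chi (s 0)) = 0
    module⟩

end

/-- The class `[K_F] ∈ H¹_{F,b}(G; ℓ¹₀(G/F))` of the cocycle
`K_F(g₀H₀, g₁H₁) = χ_{g₁H₁} - χ_{g₀H₀}`. -/
def kClass {G : Type*} [Group G] (F : SubgroupFamily G) :
    BredonCohomology F (ell1ZeroRep (G := G) (Cosets F)) 1 :=
  Submodule.Quotient.mk (kCocycle G (Cosets F))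

end BoundedBredon

end

universe u w

namespace BoundedBredon

noncomputable section

/-! ### The `ℓ¹`-norm on chains -/

/-! Relative finiteness is a statement about orbits: by orbit-stabilizer, `H` is finite relative to
`F|_H` exactly when `H` has a finite orbit on `S = G/F` (`finiteRelative_restrict_iff`).

From finiteness to isomorphisms: a finite `H`-orbit is an `H`-invariant non-empty finite subset of
`S`. Choosing one for each `H ∈ F'` gives a `G`-map `m` from `T = G/F'` to the set `N(S)` of
non-empty finite subsets of `S`. Averaging over products of finite sets extends bounded cochains
from `S` to `N(S)` without increasing norms, and restricting back to singletons recovers the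
cochain. Any two `G`-maps between `G`-sets induce the same map in cohomology, by a bounded
equivariant cone homotopy (`cochainsMap_sub_mem_coboundaries`). Hence averaging followed by pullback
along `m` inverts the canonical map (`cohomologyMap_bijective`).

From the class `[K_F]` to finiteness: suppose a cocycle `f` on `T` restricts to `K_F + δb`. If `t ∈
T` is fixed by `H`, then `χ_s + b(s) + f(s, t)` does not depend on `s ∈ S`, so it is an
`H`-invariant summable function; its sum is 1 because `b` and `f` take values in `ℓ¹₀`. A level set
at a non-zero value is finite and `H`-invariant, so it contains a finite `H`-orbit
(`finiteRelative_of_kClass_mem_range`). -/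

theorem l1Norm_nonneg {X : Type*} (c : X →₀ ℝ) : 0 ≤ l1Norm c :=
  Finset.sum_nonneg fun _ _ => abs_nonneg _

theorem l1Norm_eq_sum {X : Type*} (c : X →₀ ℝ) {s : Finset X} (hs : c.support ⊆ s) :
    l1Norm c = ∑ x ∈ s, |c x| :=
  Finsupp.sum_of_support_subset _ hs _ fun _ _ => abs_zero

theorem l1Norm_single {X : Type*} (x : X) (r : ℝ) : l1Norm (Finsupp.single x r) = |r| :=
  Finsupp.sum_single_index abs_zero

theorem l1Norm_add_le {X : Type*} (c d : X →₀ ℝ) : l1Norm (c + d) ≤ l1Norm c + l1Norm d := by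
  classical
  rw [l1Norm_eq_sum (c + d) Finsupp.support_add,
    l1Norm_eq_sum c (Finset.subset_union_left (s₂ := d.support)),
    l1Norm_eq_sum d (Finset.subset_union_right (s₁ := c.support)), ← Finset.sum_add_distrib]
  exact Finset.sum_le_sum fun x _ => abs_add_le _ _

theorem l1Norm_smul {X : Type*} (r : ℝ) (c : X →₀ ℝ) : l1Norm (r • c) = |r| * l1Norm c := by
  rw [l1Norm_eq_sum (r • c) Finsupp.support_smul, l1Norm, Finsupp.sum, Finset.mul_sum]
  exact Finset.sum_congr rfl fun x _ => abs_mul _ _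

theorem l1Norm_sub_le {X : Type*} (c d : X →₀ ℝ) : l1Norm (c - d) ≤ l1Norm c + l1Norm d := by
  have h := l1Norm_add_le c ((-1 : ℝ) • d)
  rwa [l1Norm_smul, abs_neg, abs_one, one_mul, neg_one_smul, ← sub_eq_add_neg] at h

theorem l1Norm_sum_le {ι X : Type*} (s : Finset ι) (c : ι → X →₀ ℝ) :
    l1Norm (∑ i ∈ s, c i) ≤ ∑ i ∈ s, l1Norm (c i) :=
  Finset.le_sum_of_subadditive l1Norm (by simp [l1Norm]) l1Norm_add_le s c

/-- A linear map on chains is bounded as soon as it is bounded on the basis. -/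
theorem l1Norm_map_le {X Y : Type*} (Φ : (X →₀ ℝ) →ₗ[ℝ] (Y →₀ ℝ)) {C : ℝ}
    (hC : ∀ x, l1Norm (Φ (Finsupp.single x 1)) ≤ C) (c : X →₀ ℝ) :
    l1Norm (Φ c) ≤ C * l1Norm c := by
  have hc : Φ c = ∑ x ∈ c.support, c x • Φ (Finsupp.single x 1) := by
    conv_lhs => rw [← Finsupp.sum_single c]
    rw [map_finsuppSum]
    refine Finset.sum_congr rfl fun x _ => ?_
    rw [← map_smul, Finsupp.smul_single, smul_eq_mul, mul_one]
  rw [hc, l1Norm_eq_sum c subset_rfl, Finset.mul_sum]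
  refine (l1Norm_sum_le _ _).trans (Finset.sum_le_sum fun x _ => ?_)
  rw [l1Norm_smul, mul_comm]
  exact mul_le_mul_of_nonneg_right (hC x) (abs_nonneg _)

theorem comp_mem_bHom {X Y V : Type*} [NormedAddCommGroup V] [NormedSpace ℝ V]
    {f : (Y →₀ ℝ) →ₗ[ℝ] V} (hf : f ∈ bHom Y V) (Φ : (X →₀ ℝ) →ₗ[ℝ] (Y →₀ ℝ)) {C : ℝ}
    (hC : ∀ x, l1Norm (Φ (Finsupp.single x 1)) ≤ C) : f.comp Φ ∈ bHom X V := by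
  obtain ⟨B, hB⟩ := hf
  -- `B` is not known to be nonnegative, hence the absolute value.
  refine (mem_bHom_iff _).2 ⟨|B| * C, fun x => (hB _).trans ?_⟩
  exact mul_le_mul (le_abs_self B) (hC x) (l1Norm_nonneg _) (abs_nonneg B)

theorem chains_hom_ext {X M : Type*} [AddCommGroup M] [Module ℝ M] {f g : (X →₀ ℝ) →ₗ[ℝ] M}
    (h : ∀ x, f (Finsupp.single x 1) = g (Finsupp.single x 1)) : f = g :=
  Finsupp.lhom_ext' fun x => LinearMap.ext_ring (h x)

theorem l1Norm_boundary_single_le {S : Type*} (n : ℕ) (s : Fin (n + 2) → S) :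
    l1Norm (boundary S n (Finsupp.single s 1)) ≤ n + 2 := by
  rw [boundary_single]
  refine (l1Norm_sum_le _ _).trans_eq ?_
  simp [l1Norm_single]

theorem chainsMap_chainsMap {S T U : Type*} (ψ : T → U) (φ : S → T) (n : ℕ) (c : Chains S n) :
    chainsMap ψ n (chainsMap φ n c) = chainsMap (ψ ∘ φ) n c := by
  suffices h : (chainsMap ψ n).comp (chainsMap φ n) = chainsMap (ψ ∘ φ) n from
    LinearMap.congr_fun h c
  refine chains_hom_ext fun s => ?_
  simp only [LinearMap.comp_apply, chainsMap_single, Function.comp_assoc]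

/-! ### Homotopy invariance -/

/-- The cone `(t₀, …, tₙ) ↦ (x, t₀, …, tₙ)`. -/
def cone {T : Type*} (x : T) (n : ℕ) : Chains T n →ₗ[ℝ] Chains T (n + 1) :=
  Finsupp.lmapDomain ℝ ℝ fun t => (Fin.cons x t : Fin (n + 2) → T)

theorem cone_single {T : Type*} (x : T) (n : ℕ) (t : Fin (n + 1) → T) :
    cone x n (Finsupp.single t 1) = Finsupp.single (Fin.cons x t : Fin (n + 2) → T) 1 := by
  simp [cone, Finsupp.mapDomain_single]

theorem l1Norm_cone_le {T : Type*} (x : T) (n : ℕ) (c : Chains T n) :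
    l1Norm (cone x n c) ≤ l1Norm c := by
  refine (l1Norm_map_le _ (C := 1) (fun s => ?_) c).trans_eq (one_mul _)
  rw [cone_single, l1Norm_single, abs_one]

theorem chainsMap_cone {S T : Type*} (φ : S → T) (x : S) (n : ℕ) (c : Chains S n) :
    chainsMap φ (n + 1) (cone x n c) = cone (φ x) n (chainsMap φ n c) := by
  suffices h : (chainsMap φ (n + 1)).comp (cone x n) = (cone (φ x) n).comp (chainsMap φ n) from
    LinearMap.congr_fun h c
  refine chains_hom_ext fun s => ?_
  simp only [LinearMap.comp_apply, chainsMap_single, cone_single, Fin.comp_cons]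

/-- Deleting the apex gives back `c`; deleting any other entry commutes with coning and shifts the
sign by one. So coning fills cycles. -/
theorem boundary_cone {T : Type*} (x : T) (n : ℕ) (c : Chains T (n + 1)) :
    boundary T (n + 1) (cone x (n + 1) c) = c - cone x n (boundary T n c) := by
  suffices h : (boundary T (n + 1)).comp (cone x (n + 1)) =
      LinearMap.id - (cone x n).comp (boundary T n) from LinearMap.congr_fun h c
  refine chains_hom_ext fun t => ?_
  simp only [LinearMap.comp_apply, LinearMap.sub_apply, LinearMap.id_apply, cone_single,
    boundary_single, map_sum, map_smul]
  rw [Fin.sum_univ_succ, sub_eq_add_neg, ← Finset.sum_neg_distrib]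
  congr 1
  · rw [Fin.val_zero, pow_zero, one_smul]
    rfl
  · refine Finset.sum_congr rfl fun i _ => ?_
    have hi : (Fin.cons x t : Fin (n + 3) → T) ∘ i.succ.succAbove =
        Fin.cons x (t ∘ i.succAbove) := by
      funext j
      refine Fin.cases ?_ (fun j => ?_) j <;> simp
    rw [hi, Fin.val_succ, pow_succ, mul_neg_one, neg_smul]

theorem boundary_cone_zero {T : Type*} (x : T) (t : Fin 1 → T) :
    boundary T 0 (cone x 0 (Finsupp.single t 1)) =
      Finsupp.single t 1 - Finsupp.single (fun _ => x) 1 := by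
  rw [cone_single, boundary_single, Fin.sum_univ_two, sub_eq_add_neg]
  congr 1
  · rw [Fin.val_zero, pow_zero, one_smul]
    rfl
  · rw [Fin.val_one, pow_one, neg_one_smul]
    congr 2
    funext j
    rw [Fin.fin_one_eq_zero j]
    rfl

/-- The chain homotopy between the chain maps induced by two maps `S → T`. -/
def homotopy {S T : Type*} (φ ψ : S → T) : (n : ℕ) → Chains S n →ₗ[ℝ] Chains T (n + 1)
  -- The equation `∂h + h∂ = ψ - φ` is solved degree by degree: `ψ - φ - h∂` is a cycle, and coning
  -- fills it. The apex `φ (s 0)` moves with the simplex, which keeps the construction natural and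
  -- hence equivariant; a fixed apex would not.
  | 0 => Finsupp.linearCombination ℝ fun s =>
      cone (φ (s 0)) 0 (Finsupp.single (ψ ∘ s) 1 - Finsupp.single (φ ∘ s) 1)
  | n + 1 => Finsupp.linearCombination ℝ fun s =>
      cone (φ (s 0)) (n + 1) (Finsupp.single (ψ ∘ s) 1 - Finsupp.single (φ ∘ s) 1 -
        homotopy φ ψ n (boundary S n (Finsupp.single s 1)))

theorem homotopy_zero_single {S T : Type*} (φ ψ : S → T) (s : Fin 1 → S) :
    homotopy φ ψ 0 (Finsupp.single s 1) =
      cone (φ (s 0)) 0 (Finsupp.single (ψ ∘ s) 1 - Finsupp.single (φ ∘ s) 1) := by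
  rw [homotopy, Finsupp.linearCombination_single, one_smul]

theorem homotopy_succ_single {S T : Type*} (φ ψ : S → T) (n : ℕ) (s : Fin (n + 2) → S) :
    homotopy φ ψ (n + 1) (Finsupp.single s 1) =
      cone (φ (s 0)) (n + 1) (Finsupp.single (ψ ∘ s) 1 - Finsupp.single (φ ∘ s) 1 -
        homotopy φ ψ n (boundary S n (Finsupp.single s 1))) := by
  rw [homotopy, Finsupp.linearCombination_single, one_smul]

theorem boundary_homotopy_zero {S T : Type*} (φ ψ : S → T) (c : Chains S 0) :
    boundary T 0 (homotopy φ ψ 0 c) = chainsMap ψ 0 c - chainsMap φ 0 c := by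
  suffices h : (boundary T 0).comp (homotopy φ ψ 0) = chainsMap ψ 0 - chainsMap φ 0 from
    LinearMap.congr_fun h c
  refine chains_hom_ext fun s => ?_
  simp only [LinearMap.comp_apply, LinearMap.sub_apply, homotopy_zero_single, map_sub,
    boundary_cone_zero, chainsMap_single]
  -- The two apex terms cancel.
  abel

theorem boundary_homotopy_succ {S T : Type*} (φ ψ : S → T) (n : ℕ) (c : Chains S (n + 1)) :
    boundary T (n + 1) (homotopy φ ψ (n + 1) c) =
      chainsMap ψ (n + 1) c - chainsMap φ (n + 1) c - homotopy φ ψ n (boundary S n c) := by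
  suffices h : (boundary T (n + 1)).comp (homotopy φ ψ (n + 1)) =
      chainsMap ψ (n + 1) - chainsMap φ (n + 1) - (homotopy φ ψ n).comp (boundary S n) from
    LinearMap.congr_fun h c
  refine chains_hom_ext fun s => ?_
  -- The chain being coned is a cycle, by the homotopy formula one degree lower, so the correction
  -- term of `boundary_cone` vanishes.
  have key : boundary T n (chainsMap ψ (n + 1) (Finsupp.single s 1) -
      chainsMap φ (n + 1) (Finsupp.single s 1) -
      homotopy φ ψ n (boundary S n (Finsupp.single s 1))) = 0 := by
    rw [map_sub, map_sub, boundary_chainsMap, boundary_chainsMap]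
    cases n with
    | zero => rw [boundary_homotopy_zero, sub_self]
    | succ n => rw [boundary_homotopy_succ, boundary_boundary, map_zero, sub_zero, sub_self]
  simp only [LinearMap.comp_apply, LinearMap.sub_apply, homotopy_succ_single, ← chainsMap_single]
  rw [boundary_cone, key, map_zero, sub_zero]

/-- Every ingredient of the recursion is natural, including the apex. With translations by `g⁻¹` as
`a` and `b`, this is the equivariance of the homotopy. -/
theorem chainsMap_homotopy {S S' T T' : Type*} {φ ψ : S → T} {φ' ψ' : S' → T'} {a : S → S'}
    {b : T → T'} (hφ : b ∘ φ = φ' ∘ a) (hψ : b ∘ ψ = ψ' ∘ a) (n : ℕ) (c : Chains S n) :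
    chainsMap b (n + 1) (homotopy φ ψ n c) = homotopy φ' ψ' n (chainsMap a n c) := by
  suffices h : (chainsMap b (n + 1)).comp (homotopy φ ψ n) =
      (homotopy φ' ψ' n).comp (chainsMap a n) from LinearMap.congr_fun h c
  refine chains_hom_ext fun s => ?_
  have h0 : b (φ (s 0)) = φ' ((a ∘ s) 0) := congrFun hφ (s 0)
  cases n with
  | zero =>
    simp only [LinearMap.comp_apply, homotopy_zero_single, chainsMap_single, chainsMap_cone,
      map_sub, h0, ← Function.comp_assoc, hφ, hψ]
  | succ n =>
    simp only [LinearMap.comp_apply, homotopy_succ_single, chainsMap_single, chainsMap_cone,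
      map_sub, h0, ← Function.comp_assoc, hφ, hψ]
    rw [chainsMap_homotopy hφ hψ n, ← boundary_chainsMap, chainsMap_single]

theorem exists_l1Norm_homotopy_le {S T : Type*} (φ ψ : S → T) (n : ℕ) :
    ∃ C, ∀ s, l1Norm (homotopy φ ψ n (Finsupp.single s 1)) ≤ C := by
  have h2 {n : ℕ} (s : Fin (n + 1) → S) :
      l1Norm (Finsupp.single (ψ ∘ s) 1 - Finsupp.single (φ ∘ s) (1 : ℝ)) ≤ 2 := by
    refine (l1Norm_sub_le _ _).trans_eq ?_
    rw [l1Norm_single, l1Norm_single, abs_one, one_add_one_eq_two]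
  induction n with
  | zero =>
    refine ⟨2, fun s => ?_⟩
    rw [homotopy_zero_single]
    exact (l1Norm_cone_le _ _ _).trans (h2 s)
  | succ n ih =>
    obtain ⟨C, hC⟩ := ih
    -- The two image simplices contribute 2; the boundary has `n + 2` faces, each sent to a chain of
    -- norm at most `|C|`.
    refine ⟨2 + |C| * (n + 2), fun s => ?_⟩
    rw [homotopy_succ_single]
    refine (l1Norm_cone_le _ _ _).trans ((l1Norm_sub_le _ _).trans (add_le_add (h2 s) ?_))
    refine (l1Norm_map_le _ (fun s => (hC s).trans (le_abs_self C)) _).trans ?_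
    exact mul_le_mul_of_nonneg_left (l1Norm_boundary_single_le n s) (abs_nonneg C)

section

variable {G : Type*} [Group G] {S T U : Type*} [MulAction G S] [MulAction G T] [MulAction G U]
  {V : Type*} [NormedAddCommGroup V] [NormedSpace ℝ V] (ρ : G →* (V ≃ₗᵢ[ℝ] V))

/-- The cochain homotopy induced by `homotopy`. -/
def cochainHomotopy (φ ψ : S →[G] T) (n : ℕ) (f : Cochains T ρ (n + 1)) : Cochains S ρ n :=
  Subtype.mk (f.1.comp (homotopy φ ψ n)) ⟨by
      obtain ⟨C, hC⟩ := exists_l1Norm_homotopy_le φ ψ n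
      exact comp_mem_bHom f.2.1 _ hC, fun g c => by
    have hφ (χ : S →[G] T) : (fun x : T => g⁻¹ • x) ∘ χ = χ ∘ fun x : S => g⁻¹ • x :=
      funext fun x => (map_smul χ g⁻¹ x).symm
    rw [LinearMap.comp_apply, LinearMap.comp_apply, ← chainsMap_homotopy (hφ φ) (hφ ψ), f.2.2]⟩

/-- Two `G`-maps `S → T` induce the same map in cohomology. -/
theorem cochainsMap_sub_mem_coboundaries (φ ψ : S →[G] T) (n : ℕ) {f : Cochains T ρ n}
    (hf : f ∈ cocycles T ρ n) :
    cochainsMap ψ ρ n f - cochainsMap φ ρ n f ∈ coboundaries S ρ n := by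
  have hf' (c : Chains T (n + 1)) : f.1 (boundary T n c) = 0 :=
    LinearMap.congr_fun (congrArg Subtype.val (show coboundary T ρ n f = 0 from hf)) c
  cases n with
  | zero =>
    -- In degree 0 the only coboundary is zero, so the two pullbacks must agree exactly.
    refine (Submodule.mem_bot ℝ).2 (Subtype.ext (LinearMap.ext fun c => ?_))
    change f.1 (chainsMap ψ 0 c) - f.1 (chainsMap φ 0 c) = 0
    rw [← map_sub, ← boundary_homotopy_zero, hf']
  | succ n =>
    refine ⟨cochainHomotopy ρ φ ψ n f, Subtype.ext (LinearMap.ext fun c => ?_)⟩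
    change f.1 (homotopy φ ψ n (boundary S n c)) =
      f.1 (chainsMap ψ (n + 1) c) - f.1 (chainsMap φ (n + 1) c)
    have h := hf' (homotopy φ ψ (n + 1) c)
    rw [boundary_homotopy_succ, map_sub, sub_eq_zero] at h
    rw [← h, map_sub]

theorem cochainsMap_comp (φ : S →[G] T) (ψ : T →[G] U) (n : ℕ) (f : Cochains U ρ n) :
    cochainsMap φ ρ n (cochainsMap ψ ρ n f) = cochainsMap (ψ.comp φ) ρ n f := by
  refine Subtype.ext (LinearMap.ext fun c => ?_)
  exact congrArg f.1 (chainsMap_chainsMap ψ φ n c)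

theorem cochainsMap_mem_coboundaries (φ : S →[G] T) {n : ℕ} {f : Cochains T ρ n}
    (hf : f ∈ coboundaries T ρ n) : cochainsMap φ ρ n f ∈ coboundaries S ρ n := by
  cases n with
  | zero =>
    rw [show f = 0 from hf, map_zero]
    exact Submodule.zero_mem _
  | succ n =>
    obtain ⟨b, rfl⟩ := hf
    exact ⟨cochainsMap φ ρ n b, cochainsMap_coboundary φ ρ n b⟩

end

/-! ### Extending cochains from points to finite sets. -/

/-! ### Averaging over finite subsets -/

/-- The non-empty finite subsets of `S`. -/
@[ext]
structure NonemptyFinset (S : Type*) where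
  carrier : Finset S
  nonempty : carrier.Nonempty

/-- The image of a non-empty finite subset under an embedding. -/
def NonemptyFinset.map {S T : Type*} (φ : S ↪ T) (A : NonemptyFinset S) : NonemptyFinset T :=
  ⟨A.1.map φ, A.2.map⟩

instance {G : Type*} [Group G] (S : Type*) [MulAction G S] : MulAction G (NonemptyFinset S) where
  smul g A := A.map (MulAction.toPerm g).toEmbedding
  one_smul A := NonemptyFinset.ext (Finset.ext fun x => by
    change x ∈ A.1.map _ ↔ x ∈ A.1
    simp)
  mul_smul g h A := NonemptyFinset.ext (Finset.ext fun x => by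
    change x ∈ A.1.map _ ↔ x ∈ (A.1.map _).map _
    simp [mul_smul])

/-- Each tuple with the `i`-th entry missing has `|A i|` extensions. This factor cancels one
normalising factor in `average`, which makes averaging a chain map. -/
theorem sum_piFinset_comp_succAbove {S M : Type*} [AddCommMonoid M] {n : ℕ}
    (A : Fin (n + 1) → Finset S) (i : Fin (n + 1)) (f : (Fin n → S) → M) :
    ∑ s ∈ Fintype.piFinset A, f (s ∘ i.succAbove) =
      (A i).card • ∑ s ∈ Fintype.piFinset (A ∘ i.succAbove), f s := by
  rw [← Finset.sum_const, ← Finset.sum_product']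
  refine Finset.sum_nbij' (fun s => (s i, s ∘ i.succAbove))
    (fun p => (Fin.insertNth i p.1 p.2 : Fin (n + 1) → S)) ?_ ?_ ?_ ?_ ?_
  · intro s hs
    rw [Fintype.mem_piFinset] at hs
    exact Finset.mem_product.2 ⟨hs i, Fintype.mem_piFinset.2 fun j => hs _⟩
  · rintro ⟨x, r⟩ hp
    obtain ⟨hx, hr⟩ := Finset.mem_product.1 hp
    refine Fintype.mem_piFinset.2 (i.forall_iff_succAbove.2 ⟨?_, fun j => ?_⟩)
    · simpa using hx
    · simpa using Fintype.mem_piFinset.1 hr j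
  · intro s _
    exact Fin.insertNth_self_removeNth i s
  · rintro ⟨x, r⟩ _
    refine Prod.ext ?_ (funext fun j => ?_) <;> simp
  · intro s _
    rfl

theorem sum_piFinset_map {S T M : Type*} [AddCommMonoid M] {n : ℕ} (φ : S ↪ T)
    (A : Fin n → Finset S) (f : (Fin n → T) → M) :
    ∑ t ∈ Fintype.piFinset (fun i => (A i).map φ), f t =
      ∑ s ∈ Fintype.piFinset A, f (φ ∘ s) := by
  symm
  refine Finset.sum_nbij (fun s => φ ∘ s) ?_ ?_ ?_ fun _ _ => rfl
  · intro s hs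
    rw [Fintype.mem_piFinset] at hs
    exact Fintype.mem_piFinset.2 fun i => Finset.mem_map_of_mem φ (hs i)
  · intro s _ s' _ h
    exact φ.injective.comp_left h
  · intro t ht
    have ht' := Fintype.mem_piFinset.1 ht
    choose s hs hst using fun i => Finset.mem_map.1 (ht' i)
    exact ⟨s, Fintype.mem_piFinset.2 hs, funext hst⟩

/-- The chain map `ℝ[N^(n+1)] → ℝ[S^(n+1)]` for the set `N` of non-empty finite subsets of `S`
that sends `(A₀, …, Aₙ)` to the average of the points of `A₀ × ⋯ × Aₙ`. -/
def average (S : Type*) (n : ℕ) : Chains (NonemptyFinset S) n →ₗ[ℝ] Chains S n :=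
  Finsupp.linearCombination ℝ fun A : Fin (n + 1) → NonemptyFinset S =>
    (∏ i, ((A i).1.card : ℝ)⁻¹) •
      ∑ s ∈ Fintype.piFinset (fun i => (A i).1), Finsupp.single s (1 : ℝ)

theorem average_single {S : Type*} (n : ℕ) (A : Fin (n + 1) → NonemptyFinset S) :
    average S n (Finsupp.single A 1) = (∏ i, ((A i).1.card : ℝ)⁻¹) •
      ∑ s ∈ Fintype.piFinset (fun i => (A i).1), Finsupp.single s (1 : ℝ) := by
  rw [average, Finsupp.linearCombination_single, one_smul]

theorem card_ne_zero {S : Type*} (A : NonemptyFinset S) : (A.1.card : ℝ) ≠ 0 :=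
  Nat.cast_ne_zero.2 A.2.card_pos.ne'

theorem l1Norm_average_single_le {S : Type*} (n : ℕ) (A : Fin (n + 1) → NonemptyFinset S) :
    l1Norm (average S n (Finsupp.single A 1)) ≤ 1 := by
  rw [average_single, l1Norm_smul, abs_of_nonneg (by positivity)]
  refine (mul_le_mul_of_nonneg_left (l1Norm_sum_le _ _) (by positivity)).trans_eq ?_
  simp only [l1Norm_single, abs_one, Finset.sum_const, nsmul_eq_mul, mul_one,
    Fintype.card_piFinset, Nat.cast_prod]
  rw [← Finset.prod_mul_distrib]
  exact Finset.prod_eq_one fun i _ => inv_mul_cancel₀ (card_ne_zero _)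

theorem boundary_average {S : Type*} (n : ℕ) (c : Chains (NonemptyFinset S) (n + 1)) :
    boundary S n (average S (n + 1) c) = average S n (boundary (NonemptyFinset S) n c) := by
  suffices h : (boundary S n).comp (average S (n + 1)) =
      (average S n).comp (boundary (NonemptyFinset S) n) from LinearMap.congr_fun h c
  refine chains_hom_ext fun A => ?_
  simp only [LinearMap.comp_apply, average_single, boundary_single, map_sum, map_smul]
  rw [Finset.sum_comm, Finset.smul_sum]
  refine Finset.sum_congr rfl fun i _ => ?_
  rw [← Finset.smul_sum, smul_comm, sum_piFinset_comp_succAbove (fun i => (A i).1) i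
    fun s => Finsupp.single s (1 : ℝ), Fin.prod_univ_succAbove _ i, ← Nat.cast_smul_eq_nsmul ℝ,
    smul_smul, smul_smul, mul_assoc, mul_right_comm _ _ ((A i).1.card : ℝ), inv_mul_cancel₀ (card_ne_zero _), one_mul, mul_smul]
  rfl

/-- An injection preserves cardinalities, and so the normalising factors. This serves both for
translations by group elements and for injective `G`-maps `S → T`. -/
theorem chainsMap_average {S T : Type*} (φ : S ↪ T) (n : ℕ) (c : Chains (NonemptyFinset S) n) :
    chainsMap φ n (average S n c) = average T n (chainsMap (NonemptyFinset.map φ) n c) := by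
  suffices h : (chainsMap φ n).comp (average S n) =
      (average T n).comp (chainsMap (NonemptyFinset.map φ) n) from LinearMap.congr_fun h c
  refine chains_hom_ext fun A => ?_
  simp only [LinearMap.comp_apply, chainsMap_single, average_single, map_smul, map_sum]
  have h := sum_piFinset_map φ (fun i => (A i).1) fun t => Finsupp.single t (1 : ℝ)
  refine congrArg₂ _ ?_ h.symm
  refine Finset.prod_congr rfl fun i _ => ?_
  exact congrArg (fun k : ℕ => (k : ℝ)⁻¹) (Finset.card_map φ).symm

section

variable {G : Type*} [Group G] {S T : Type*} [MulAction G S] [MulAction G T]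
  {V : Type*} [NormedAddCommGroup V] [NormedSpace ℝ V] (ρ : G →* (V ≃ₗᵢ[ℝ] V))

/-- The inclusion of `S` into its non-empty finite subsets. -/
def singletonMap (G : Type*) [Group G] (S : Type*) [MulAction G S] : S →[G] NonemptyFinset S where
  toFun x := ⟨{x}, Finset.singleton_nonempty x⟩
  map_smul' g x := NonemptyFinset.ext (Finset.map_singleton (MulAction.toPerm g).toEmbedding x).symm

/-- The `G`-map on non-empty finite subsets induced by an injective `G`-map. -/
def nonemptyFinsetMap (φ : S →[G] T) (hφ : Function.Injective φ) :
    NonemptyFinset S →[G] NonemptyFinset T where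
  toFun := NonemptyFinset.map ⟨φ, hφ⟩
  map_smul' g A := NonemptyFinset.ext (by
    change (A.1.map _).map _ = (A.1.map _).map _
    rw [Finset.map_map, Finset.map_map]
    congr 1
    ext x
    exact map_smul φ g x)

/-- The cochain map induced by `average`. -/
def averageCochain (n : ℕ) : Cochains S ρ n →ₗ[ℝ] Cochains (NonemptyFinset S) ρ n where
  toFun f := Subtype.mk (f.1.comp (average S n))
    ⟨comp_mem_bHom f.2.1 _ (l1Norm_average_single_le n), fun g c => by
      have h := chainsMap_average (MulAction.toPerm (α := G) (β := S) g⁻¹).toEmbedding n c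
      refine Eq.trans ?_ (f.2.2 g (average S n c))
      exact congrArg (fun d => ρ g (f.1 d)) h.symm⟩
  map_add' _ _ := rfl
  map_smul' _ _ := rfl

theorem averageCochain_coboundary (n : ℕ) (f : Cochains S ρ n) :
    coboundary (NonemptyFinset S) ρ n (averageCochain ρ n f) =
      averageCochain ρ (n + 1) (coboundary S ρ n f) := by
  refine Subtype.ext (LinearMap.ext fun c => ?_)
  exact congrArg f.1 (boundary_average n c).symm

theorem averageCochain_mem_cocycles {n : ℕ} {f : Cochains S ρ n} (hf : f ∈ cocycles S ρ n) :
    averageCochain ρ n f ∈ cocycles (NonemptyFinset S) ρ n := by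
  change coboundary _ ρ n _ = 0
  rw [averageCochain_coboundary, show coboundary S ρ n f = 0 from hf, map_zero]

theorem averageCochain_mem_coboundaries {n : ℕ} {f : Cochains S ρ n}
    (hf : f ∈ coboundaries S ρ n) :
    averageCochain ρ n f ∈ coboundaries (NonemptyFinset S) ρ n := by
  cases n with
  | zero =>
    rw [show f = 0 from hf, map_zero]
    exact Submodule.zero_mem _
  | succ n =>
    obtain ⟨b, rfl⟩ := hf
    exact ⟨averageCochain ρ n b, averageCochain_coboundary ρ n b⟩

/-- The average over a product of singletons is a single tuple. -/
theorem cochainsMap_averageCochain (n : ℕ) (f : Cochains S ρ n) :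
    cochainsMap (singletonMap G S) ρ n (averageCochain ρ n f) = f := by
  refine Subtype.ext (chains_hom_ext fun s => ?_)
  change f.1 (average S n (chainsMap _ n (Finsupp.single s 1))) = f.1 (Finsupp.single s 1)
  rw [chainsMap_single, average_single]
  have h : (Fintype.piFinset fun i => ((singletonMap G S ∘ s) i).1) = {s} :=
    Fintype.piFinset_singleton s
  rw [h, Finset.sum_singleton, Finset.prod_eq_one, one_smul]
  intro i _
  change ((Finset.card {s i} : ℕ) : ℝ)⁻¹ = 1
  simp

theorem averageCochain_cochainsMap (φ : S →[G] T) (hφ : Function.Injective φ) (n : ℕ)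
    (f : Cochains T ρ n) :
    averageCochain ρ n (cochainsMap φ ρ n f) =
      cochainsMap (nonemptyFinsetMap φ hφ) ρ n (averageCochain ρ n f) := by
  refine Subtype.ext (LinearMap.ext fun c => ?_)
  exact congrArg f.1 (chainsMap_average ⟨φ, hφ⟩ n c)

theorem cochainsMap_mem_cocycles (φ : S →[G] T) {n : ℕ} {f : Cochains T ρ n}
    (hf : f ∈ cocycles T ρ n) : cochainsMap φ ρ n f ∈ cocycles S ρ n :=
  (cocyclesMap φ ρ n ⟨f, hf⟩).2

/-- An injective `G`-map `S → T` induces isomorphisms in cohomology if there is a `G`-map from `T`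
to the non-empty finite subsets of `S`. -/
theorem cohomologyMap_bijective (φ : S →[G] T) (hφ : Function.Injective φ)
    (m : T →[G] NonemptyFinset S) (n : ℕ) : Function.Bijective (cohomologyMap φ ρ n) := by
  constructor
  · refine (injective_iff_map_eq_zero _).2 fun x hx => ?_
    obtain ⟨f, rfl⟩ := Submodule.Quotient.mk_surjective _ x
    have hx' : cochainsMap φ ρ n f.1 ∈ coboundaries S ρ n :=
      (Submodule.Quotient.mk_eq_zero ((coboundaries S ρ n).submoduleOf _)).1 hx
    refine (Submodule.Quotient.mk_eq_zero _).2 ?_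
    change f.1 ∈ coboundaries T ρ n
    -- Two `G`-maps from `T` to the finite subsets of `T` are compared: the singleton map, which
    -- pulls the averaged `f` back to `f`, and `m` followed by `φ`, which pulls it back to a
    -- coboundary.
    have h1 := cochainsMap_mem_coboundaries ρ m (averageCochain_mem_coboundaries ρ hx')
    have h2 := cochainsMap_sub_mem_coboundaries ρ ((nonemptyFinsetMap φ hφ).comp m)
      (singletonMap G T) n (averageCochain_mem_cocycles ρ f.2)
    rw [averageCochain_cochainsMap ρ φ hφ, cochainsMap_comp] at h1
    rw [cochainsMap_averageCochain] at h2
    simpa using Submodule.add_mem _ h2 h1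
  · intro x
    obtain ⟨f, rfl⟩ := Submodule.Quotient.mk_surjective _ x
    have hf := averageCochain_mem_cocycles ρ f.2
    -- The preimage is the averaged cocycle pulled back along `m`; `m ∘ φ` and the singleton map
    -- then agree in cohomology.
    refine ⟨Submodule.Quotient.mk ⟨_, cochainsMap_mem_cocycles ρ m hf⟩, ?_⟩
    refine (Submodule.Quotient.eq _).2 ?_
    change cochainsMap φ ρ n (cochainsMap m ρ n (averageCochain ρ n f.1)) - f.1 ∈
      coboundaries S ρ n
    have h := cochainsMap_sub_mem_coboundaries ρ (singletonMap G S) (m.comp φ) n hf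
    rwa [cochainsMap_averageCochain, ← cochainsMap_comp] at h

end

/-! ### From finiteness to isomorphisms -/

section

variable {G : Type*} [Group G] {F F' : SubgroupFamily G}

theorem stabilizer_cosets (x : Cosets F) :
    MulAction.stabilizer G x = MulAction.stabilizer G x.2 := by
  obtain ⟨H, q⟩ := x
  ext g
  exact Sigma.mk.inj_iff.trans (by simp)

/-- Point stabilizers are conjugates of members of `F`. -/
theorem stabilizer_mem (x : Cosets F) : MulAction.stabilizer G x ∈ F.carrier := by
  rw [stabilizer_cosets]
  obtain ⟨⟨H, hH⟩, q⟩ := x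
  obtain ⟨a, rfl⟩ := QuotientGroup.mk_surjective q
  have h := MulAction.stabilizer_smul_eq_stabilizer_map_conj a ((1 : G) : G ⧸ H)
  rw [MulAction.stabilizer_quotient, MulAction.Quotient.smul_coe, smul_eq_mul, mul_one] at h
  change MulAction.stabilizer G (a : G ⧸ H) ∈ _
  rw [h]
  exact F.conj_mem H hH a

theorem finiteIndex_stabilizer_iff {H X : Type*} [Group H] [MulAction H X] (x : X) :
    (MulAction.stabilizer H x).FiniteIndex ↔ (MulAction.orbit H x).Finite := by
  rw [Subgroup.finiteIndex_iff_finite_quotient, ← Set.finite_coe_iff]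
  exact (MulAction.orbitEquivQuotientStabilizer H x).symm.finite_iff

theorem finiteRelative_restrict_iff {H : Subgroup G} :
    FiniteRelative (F.restrict H) ↔ ∃ x : Cosets F, (MulAction.orbit H x).Finite := by
  constructor
  · rintro ⟨_, ⟨L, hL, rfl⟩, hfin⟩
    refine ⟨⟨⟨L, hL⟩, ((1 : G) : G ⧸ L)⟩, (finiteIndex_stabilizer_iff _).1 ?_⟩
    convert hfin using 1
    change (MulAction.stabilizer G _).subgroupOf H = _
    rw [stabilizer_cosets, MulAction.stabilizer_quotient]
  · rintro ⟨x, hx⟩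
    exact ⟨_, ⟨_, stabilizer_mem x, rfl⟩, (finiteIndex_stabilizer_iff x).2 hx⟩

/-- A finite `H`-orbit serves as the invariant set. -/
theorem exists_smul_invariant {H : Subgroup G} (hH : FiniteRelative (F.restrict H)) :
    ∃ A : NonemptyFinset (Cosets F), ∀ h ∈ H, h • A = A := by
  obtain ⟨x, hO⟩ := finiteRelative_restrict_iff.1 hH
  refine ⟨⟨hO.toFinset, x, hO.mem_toFinset.2 (MulAction.mem_orbit_self x)⟩,
    fun h hh => NonemptyFinset.ext (Finset.ext fun y => ?_)⟩
  change y ∈ hO.toFinset.map (MulAction.toPerm h).toEmbedding ↔ y ∈ hO.toFinset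
  rw [Finset.mem_map_equiv, hO.mem_toFinset, hO.mem_toFinset]
  have ho := MulAction.orbit_smul (⟨h, hh⟩ : H)⁻¹ y
  refine MulAction.orbit_eq_iff.symm.trans (Iff.trans ?_ MulAction.orbit_eq_iff)
  exact iff_of_eq (congrArg (· = MulAction.orbit H x) ho)

/-- A `G`-map from `G/F` to `X`, given by points of `X` fixed by the subgroups in `F`. -/
def cosetsLift {X : Type*} [MulAction G X] (A : {H : Subgroup G // H ∈ F.carrier} → X)
    (hA : ∀ H, ∀ h ∈ H.1, h • A H = A H) : Cosets F →[G] X where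
  toFun x := Quotient.lift (s := QuotientGroup.leftRel x.1.1) (fun g => g • A x.1) (by
    intro a b hab
    have h := hA x.1 _ (QuotientGroup.leftRel_apply.1 hab)
    change a • A x.1 = b • A x.1
    rw [← h, smul_smul, mul_inv_cancel_left, h]) x.2
  map_smul' g x := by
    obtain ⟨H, x⟩ := x
    obtain ⟨a, rfl⟩ := QuotientGroup.mk_surjective x
    exact mul_smul g a (A H)

theorem cosetsIncl_injective (h : F.carrier ⊆ F'.carrier) :
    Function.Injective (cosetsIncl h) := by
  rintro ⟨⟨H, hH⟩, x⟩ ⟨⟨K, hK⟩, y⟩ hxy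
  obtain ⟨h1, h2⟩ := Sigma.mk.inj hxy
  obtain rfl : H = K := congrArg Subtype.val h1
  exact congrArg _ (eq_of_heq h2)

theorem can_bijective (h : F.carrier ⊆ F'.carrier)
    (hfin : ∀ H ∈ F'.carrier, FiniteRelative (F.restrict H))
    {V : Type*} [NormedAddCommGroup V] [NormedSpace ℝ V] (ρ : G →* (V ≃ₗᵢ[ℝ] V)) (n : ℕ) :
    Function.Bijective (can h ρ n) := by
  choose A hA using fun H : {H : Subgroup G // H ∈ F'.carrier} =>
    exists_smul_invariant (hfin H.1 H.2)
  exact cohomologyMap_bijective ρ _ (cosetsIncl_injective h) (cosetsLift A hA) n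

end

/-! ### The class `[K_F]` -/

section

variable {G : Type*} [Group G] {F F' : SubgroupFamily G}

theorem kClass_mem_range_iff (h : F.carrier ⊆ F'.carrier) :
    kClass F ∈ LinearMap.range (can h (ell1ZeroRep (G := G) (Cosets F)) 1) ↔
      ∃ f ∈ cocycles (Cosets F') (ell1ZeroRep (G := G) (Cosets F)) 1,
        cochainsMap (cosetsIncl h) _ 1 f - kCochain G (Cosets F) ∈
          coboundaries (Cosets F) (ell1ZeroRep (G := G) (Cosets F)) 1 := by
  constructor
  · rintro ⟨x, hx⟩
    obtain ⟨f, rfl⟩ := Submodule.Quotient.mk_surjective _ x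
    exact ⟨f.1, f.2, (Submodule.Quotient.eq ((coboundaries _ _ 1).submoduleOf _)).1 hx⟩
  · rintro ⟨f, hf, hfk⟩
    exact ⟨Submodule.Quotient.mk ⟨f, hf⟩,
      (Submodule.Quotient.eq ((coboundaries _ _ 1).submoduleOf _)).2 hfk⟩

end

/-! ### Change of coefficients -/

section

variable {G : Type*} [Group G] {S T : Type*} [MulAction G S] [MulAction G T]
  {V W : Type*} [NormedAddCommGroup V] [NormedSpace ℝ V] [NormedAddCommGroup W] [NormedSpace ℝ W]

/-- The isometric representation obtained by transport along an isometric isomorphism. -/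
def conjRep (ρ : G →* (V ≃ₗᵢ[ℝ] V)) (J : W ≃ₗᵢ[ℝ] V) : G →* (W ≃ₗᵢ[ℝ] W) where
  toFun g := (J.trans (ρ g)).trans J.symm
  map_one' := LinearIsometryEquiv.ext fun w => by simp
  map_mul' g g' := LinearIsometryEquiv.ext fun w => by simp

variable {ρ : G →* (V ≃ₗᵢ[ℝ] V)} {σ : G →* (W ≃ₗᵢ[ℝ] W)}

/-- The map on cochains induced by an equivariant isometry of coefficients. -/
def coeffMap (J : V →ₗᵢ[ℝ] W) (hJ : ∀ g v, J (ρ g v) = σ g (J v)) (n : ℕ) :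
    Cochains S ρ n →ₗ[ℝ] Cochains S σ n where
  toFun f := Subtype.mk (J.toLinearMap.comp f.1)
    ⟨by
      obtain ⟨C, hC⟩ := f.2.1
      exact ⟨C, fun c => (J.norm_map _).trans_le (hC c)⟩, fun g c => by
      refine (hJ g _).symm.trans ?_
      rw [f.2.2]
      rfl⟩
  map_add' f f' := Subtype.ext (LinearMap.comp_add f.1 f'.1 J.toLinearMap)
  map_smul' r f := Subtype.ext (LinearMap.comp_smul J.toLinearMap r f.1)

theorem coeffMap_mem_cocycles (J : V →ₗᵢ[ℝ] W) (hJ : ∀ g v, J (ρ g v) = σ g (J v)) {n : ℕ}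
    {f : Cochains S ρ n} (hf : f ∈ cocycles S ρ n) : coeffMap J hJ n f ∈ cocycles S σ n := by
  change coeffMap J hJ (n + 1) (coboundary S ρ n f) = 0
  rw [show coboundary S ρ n f = 0 from hf, map_zero]

theorem coeffMap_mem_coboundaries (J : V →ₗᵢ[ℝ] W) (hJ : ∀ g v, J (ρ g v) = σ g (J v)) {n : ℕ}
    {f : Cochains S ρ n} (hf : f ∈ coboundaries S ρ n) :
    coeffMap J hJ n f ∈ coboundaries S σ n := by
  cases n with
  | zero =>
    rw [show f = 0 from hf, map_zero]
    exact Submodule.zero_mem _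
  | succ n =>
    obtain ⟨b, rfl⟩ := hf
    exact ⟨coeffMap J hJ n b, rfl⟩

end

section

variable {G : Type*} [Group G] {F F' : SubgroupFamily G}

/-- Surjectivity of the canonical map for coefficients isometric to `ℓ¹₀(G/F)` suffices to lift
`[K_F]`. -/
theorem kClass_mem_range_of_surjective (h : F.carrier ⊆ F'.carrier) {W : Type*}
    [NormedAddCommGroup W] [NormedSpace ℝ W] (J : W ≃ₗᵢ[ℝ] ell1Zero (Cosets F))
    (hs : Function.Surjective (can h (conjRep (ell1ZeroRep (G := G) (Cosets F)) J) 1)) :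
    kClass F ∈ LinearMap.range (can h (ell1ZeroRep (G := G) (Cosets F)) 1) := by
  have hJ (g : G) (w : W) : J.toLinearIsometry (conjRep (ell1ZeroRep (Cosets F)) J g w) =
      ell1ZeroRep (Cosets F) g (J.toLinearIsometry w) := J.apply_symm_apply _
  have hJ' (g : G) (v : ell1Zero (Cosets F)) :
      J.symm.toLinearIsometry (ell1ZeroRep (Cosets F) g v) =
        conjRep (ell1ZeroRep (Cosets F)) J g (J.symm.toLinearIsometry v) := by
    change J.symm _ = J.symm (ell1ZeroRep (Cosets F) g (J (J.symm v)))
    rw [J.apply_symm_apply]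
  let k := coeffMap J.symm.toLinearIsometry hJ' 1 (kCochain G (Cosets F))
  have hk : k ∈ cocycles _ _ 1 := coeffMap_mem_cocycles _ hJ' (kCocycle G (Cosets F)).2
  obtain ⟨x, hx⟩ := hs (Submodule.Quotient.mk ⟨k, hk⟩)
  obtain ⟨f, rfl⟩ := Submodule.Quotient.mk_surjective _ x
  have hfk : cochainsMap (cosetsIncl h) _ 1 f.1 - k ∈ coboundaries _ _ 1 :=
    (Submodule.Quotient.eq ((coboundaries _ _ 1).submoduleOf _)).1 hx
  refine (kClass_mem_range_iff h).2
    ⟨coeffMap J.toLinearIsometry hJ 1 f.1, coeffMap_mem_cocycles _ hJ f.2, ?_⟩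
  have hkk : coeffMap J.toLinearIsometry hJ 1 k = kCochain G (Cosets F) :=
    Subtype.ext (LinearMap.ext fun c => J.apply_symm_apply _)
  have hc := coeffMap_mem_coboundaries J.toLinearIsometry hJ hfk
  rwa [map_sub, hkk] at hc

/-! ### Finite orbits from a lift of `[K_F]`. -/

/-- An `H`-invariant summable function with non-zero sum has a finite `H`-orbit in its support. -/
theorem exists_finite_orbit {H S : Type*} [Group H] [MulAction H S] (w : S → ℝ) (hw : Summable w)
    (hsum : ∑' x, w x ≠ 0) (hinv : ∀ (h : H) (x : S), w (h • x) = w x) :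
    ∃ x : S, (MulAction.orbit H x).Finite := by
  obtain ⟨x, hx⟩ : ∃ x, w x ≠ 0 := by
    by_contra! h0
    exact hsum (by simp [h0])
  -- A summable function tends to zero along the cofinite filter, so it takes the non-zero value `w
  -- x` only finitely often.
  have hfin : {y | ¬ w y ≠ w x}.Finite :=
    Filter.eventually_cofinite.1 (hw.tendsto_cofinite_zero.eventually_ne hx.symm)
  refine ⟨x, hfin.subset ?_⟩
  rintro _ ⟨h, rfl⟩
  exact not_not.2 (hinv h x)

/-- The value of an invariant cochain on the translate of a tuple. -/
theorem invariant_apply_smul {S V : Type*} [MulAction G S] [NormedAddCommGroup V] [NormedSpace ℝ V]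
    {ρ : G →* (V ≃ₗᵢ[ℝ] V)} {n : ℕ} (f : Cochains S ρ n) (g : G) (s : Fin (n + 1) → S) :
    f.1 (Finsupp.single (fun i => g • s i) 1) = ρ g (f.1 (Finsupp.single s 1)) := by
  rw [← f.2.2 g, chainsMap_single]
  have hs : (fun x : S => g⁻¹ • x) ∘ (fun i => g • s i) = s :=
    funext fun i => inv_smul_smul g (s i)
  rw [hs]

theorem finiteRelative_of_kClass_mem_range (h : F.carrier ⊆ F'.carrier)
    (hk : kClass F ∈ LinearMap.range (can h (ell1ZeroRep (G := G) (Cosets F)) 1))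
    {H : Subgroup G} (hH : H ∈ F'.carrier) : FiniteRelative (F.restrict H) := by
  obtain ⟨f, hf, b, hb⟩ := (kClass_mem_range_iff h).1 hk
  obtain ⟨L, hL⟩ := F.nonempty
  -- The base coset of `G/H`, a point of `G/F'` fixed by `H`.
  let t : Cosets F' := ⟨⟨H, hH⟩, ((1 : G) : G ⧸ H)⟩
  have ht (g : H) : (g : G) • t = t := by
    have hg : (g : G) ∈ MulAction.stabilizer G t := by
      rw [stabilizer_cosets, MulAction.stabilizer_quotient]
      exact g.2
    exact hg
  let φ := cosetsIncl h
  let fv (x y : Cosets F') : ell1Zero (Cosets F) := f.1 (Finsupp.single ![x, y] 1)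
  let bv (s : Cosets F) : ell1Zero (Cosets F) := b.1 (Finsupp.single (fun _ => s) 1)
  have hfv (x y z : Cosets F') : fv y z - fv x z + fv x y = 0 := by
    have h0 : f.1 (boundary _ 1 (Finsupp.single ![x, y, z] 1)) = 0 :=
      LinearMap.congr_fun (congrArg Subtype.val (show coboundary _ _ 1 f = 0 from hf)) _
    have e0 : ![x, y, z] ∘ (0 : Fin 3).succAbove = ![y, z] := by
      funext i; fin_cases i <;> rfl
    have e1 : ![x, y, z] ∘ (1 : Fin 3).succAbove = ![x, z] := by
      funext i; fin_cases i <;> rfl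
    have e2 : ![x, y, z] ∘ (2 : Fin 3).succAbove = ![x, y] := by
      funext i; fin_cases i <;> rfl
    rw [boundary_single, Fin.sum_univ_three, e0, e1, e2, map_add, map_add, map_smul, map_smul,
      map_smul] at h0
    simpa [sub_eq_add_neg] using h0
  have hbv (x y : Cosets F) : bv y - bv x = fv (φ x) (φ y) - chiDiff x y := by
    have h0 : b.1 (boundary _ 0 (Finsupp.single ![x, y] 1)) =
        f.1 (chainsMap φ 1 (Finsupp.single ![x, y] 1)) - kMap _ (Finsupp.single ![x, y] 1) :=
      LinearMap.congr_fun (congrArg Subtype.val hb) _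
    have e0 : ![x, y] ∘ (0 : Fin 2).succAbove = fun _ => y := by
      funext i; fin_cases i; rfl
    have e1 : ![x, y] ∘ (1 : Fin 2).succAbove = fun _ => x := by
      funext i; fin_cases i; rfl
    have e2 : φ ∘ ![x, y] = ![φ x, φ y] := by
      funext i; fin_cases i <;> rfl
    rw [boundary_single, Fin.sum_univ_two, e0, e1, chainsMap_single, e2, kMap_single, map_add,
      map_smul, map_smul] at h0
    simpa [sub_eq_add_neg] using h0
  have hfg (g : G) (x y : Cosets F') : fv (g • x) (g • y) = ell1ZeroRep _ g (fv x y) := by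
    have e : (![g • x, g • y] : Fin 2 → Cosets F') = fun i => g • ![x, y] i := by
      funext i; fin_cases i <;> rfl
    refine Eq.trans ?_ (invariant_apply_smul f g ![x, y])
    rw [← e]
  have hbg (g : G) (x : Cosets F) : bv (g • x) = ell1ZeroRep _ g (bv x) :=
    invariant_apply_smul b g fun _ => x
  -- By `hbv`, `χ + b` changes by `f(φ x, φ y)` between `x` and `y`; by the cocycle identity, `f(φ
  -- ·, t)` changes by the opposite amount. So `w` is constant in `s`.
  let w (s : Cosets F) : lp (fun _ : Cosets F => ℝ) 1 := chi s + (bv s).1 + (fv (φ s) t).1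
  have hw (x y : Cosets F) : w x = w y := by
    have h1 : (fv (φ y) t).1 - (fv (φ x) t).1 + (fv (φ x) (φ y)).1 = 0 :=
      congrArg Subtype.val (hfv (φ x) (φ y) t)
    have h2 : (bv y).1 - (bv x).1 = (fv (φ x) (φ y)).1 - (chi y - chi x) :=
      congrArg Subtype.val (hbv x y)
    have h3 : w x - w y = -((fv (φ y) t).1 - (fv (φ x) t).1 + (fv (φ x) (φ y)).1) -
        ((bv y).1 - (bv x).1 - ((fv (φ x) (φ y)).1 - (chi y - chi x))) := by
      simp only [w]
      abel
    rw [h1, h2, sub_self, neg_zero, sub_zero] at h3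
    exact sub_eq_zero.1 h3
  let s : Cosets F := ⟨⟨L, hL⟩, ((1 : G) : G ⧸ L)⟩
  refine finiteRelative_restrict_iff.2 (exists_finite_orbit (w s) (summable_ell1 _) ?_ ?_)
  · have h1 : ∑' y, (w s) y = ∑' y, chi s y + ∑' y, (bv s).1 y + ∑' y, (fv (φ s) t).1 y := by
      rw [← (summable_ell1 _).tsum_add (summable_ell1 _),
        ← ((summable_ell1 _).add (summable_ell1 _)).tsum_add (summable_ell1 _)]
      rfl
    have h2 : ∑' y, chi s y = 1 := by
      classical
      refine (tsum_congr (chi_apply s)).trans ?_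
      convert tsum_ite_eq s fun _ => (1 : ℝ)
    rw [h1, h2, show ∑' y, (bv s).1 y = 0 from (bv s).2,
      show ∑' y, (fv (φ s) t).1 y = 0 from (fv (φ s) t).2, add_zero, add_zero]
    exact one_ne_zero
  · intro g y
    -- Constancy allows `s` to be replaced by `g • s`; since `g` fixes `t`, each of the three terms
    -- is then equivariant.
    have h0 : w s (g • y) = w ((g : G) • s) (g • y) := by rw [hw s ((g : G) • s)]
    refine h0.trans ?_
    change chi ((g : G) • s) ((g : G) • y) + (bv ((g : G) • s)).1 ((g : G) • y) +
      (fv (φ ((g : G) • s)) t).1 ((g : G) • y) = chi s y + (bv s).1 y + (fv (φ s) t).1 y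
    have h1 : fv (φ ((g : G) • s)) t = ell1ZeroRep _ (g : G) (fv (φ s) t) := by
      rw [← hfg, ht, map_smul]
    rw [chi_smul, hbg, h1]
    change _ + (bv s).1 ((g : G)⁻¹ • (g : G) • y) + (fv (φ s) t).1 ((g : G)⁻¹ • (g : G) • y) = _
    rw [inv_smul_smul]

end

end

end BoundedBredon

theorem mainTheorem9 {G : Type u} [Group G] (F F' : BoundedBredon.SubgroupFamily G)
    (hFF' : F.carrier ⊆ F'.carrier) :
    List.TFAE
      [∀ H ∈ F'.carrier, BoundedBredon.FiniteRelative (F.restrict H),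
        ∀ (V : Type (max u w)) [NormedAddCommGroup V] [NormedSpace ℝ V]
          (ρ : G →* (V ≃ₗᵢ[ℝ] V)) (n : ℕ), Function.Bijective (BoundedBredon.can hFF' ρ n),
        ∀ (V : Type (max u w)) [NormedAddCommGroup V] [NormedSpace ℝ V]
          (ρ : G →* (V ≃ₗᵢ[ℝ] V)), Function.Bijective (BoundedBredon.can hFF' ρ 1),
        BoundedBredon.kClass F ∈ LinearMap.range
          (BoundedBredon.can hFF'
            (BoundedBredon.ell1ZeroRep (G := G) (BoundedBredon.Cosets F)) 1)] := by
  tfae_have 1 → 2 := fun h V _ _ ρ n => BoundedBredon.can_bijective hFF' h ρ n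
  tfae_have 2 → 3 := fun h V _ _ ρ => h V ρ 1
  tfae_have 3 → 4 := fun h =>
    BoundedBredon.kClass_mem_range_of_surjective hFF'
      -- `ℓ¹₀(G/F)` lives in `Type u`, whereas the coefficients range over `Type (max u w)`; an
      -- isometric copy in the larger universe bridges the gap.
      (W := ULift.{max u w} (BoundedBredon.ell1Zero (BoundedBredon.Cosets F)))
      (LinearIsometryEquiv.ulift ℝ (BoundedBredon.ell1Zero (BoundedBredon.Cosets F)))
      (h _ _).2
  tfae_have 4 → 1 := fun h H hH => BoundedBredon.finiteRelative_of_kClass_mem_range hFF' h hH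
  tfae_finish
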